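/- Let $m,n,d$ be natural numbers, let $f:\mathbb{R}^{m\times n}\times\mathbb{R}^{m\times n}\to[0,\infty)$ be locally Lipschitz continuous, let $\lambda,\beta\ge 0$, and let $\mathcal B=\{S\in\mathbb{R}^{m\times n}:\kappa^1_{ij}\le S_{ij}\le\kappa^2_{ij}\ \forall i,j\}$ with $\kappa^1_{ij}\in[-\infty,0]$ and $\kappa^2_{ij}\in[0,+\infty]$. Let $\|S\|_0$ be the number of nonzero entries of $S$ and $\mathrm{nnzc}(X)$ the number of nonzero columns of $X$. Consider the problems $$\text{(L)}\quad \min_{Z\in\mathbb{R}^{m\times n},\ S\in\mathcal B,\ \mathrm{rank}(Z)\le d}\ f(Z,S)+2\lambda\,\mathrm{rank}(Z)+\beta\|S\|_0,$$ $$\text{(F)}\quad \min_{X\in\mathbb{R}^{m\times d},\ Y\in\mathbb{R}^{n\times d},\ S\in\mathcal B}\ f(XY^{\mathbb T},S)+\lambda\big(\mathrm{nnzc}(X)+\mathrm{nnzc}(Y)\big)+\beta\|S\|_0.$$ Matrix spaces carry the inner product $\langle A,B\rangle=\mathrm{trace}(A^{\mathbb T}B)$. For a set $\Omega$ and $U\in\Omega$,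 $N_\Omega(U)$ is the limiting normal cone: the set of limits of sequences $V^k$ such that there are $U^k\in\Omega$, $U^k\to U$, with $\langle V^k,Z-U^k\rangle\le o(\|Z-U^k\|)$ as $Z\to U^k$ in $\Omega$, for every $k$; $N_\Omega(U)=\emptyset$ if $U\notin\Omega$. Further, $\partial f(p)$ is the limiting subdifferential: the set of limits of sequences $H^k$ such that there are $p^k\to p$ with $f(p^k)\to f(p)$ and $f(q)\ge f(p^k)+\langle H^k,q-p^k\rangle-o(\|q-p^k\|)$ as $q\to p^k$, for every $k$. For a matrix $X$ with $d$ columns let $\mathbb I_X$ be the set of indices of its nonzero columns if $\lambda>0$, and the set of all column indices if $\lambda=0$; let $\mathcal C_X$ be the set of all matrices of the size of $X$ whose columns with index outside $\mathbb I_X$ are zero. For $S\in\mathbb{R}^{m\times n}$ let $\mathbb J_S$ be the set of positions of its nonzero entries if $\beta>0$, and the set of all positions if $\beta=0$; let $\mathcal B_S$ be the set of all matrices obtained from a matrix in $\mathcal B$ by replacing the entries at positions outside $\mathbb J_S$ by $0$. For $Z\in\mathbb{R}^{m\times n}$ let $\mathcal R_Z=\{W\in\mathbb{R}^{m\times n}:\mathrm{rank}(W)\le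 d,\ \lambda\,\mathrm{rank}(W)=\lambda\,\mathrm{rank}(Z)\}$. A pair $(Z,S)\in\mathbb{R}^{m\times n}\times\mathcal B$ is a stationary point of (L) if there is $(H_Z,H_S)\in\partial f(Z,S)$ with $-H_Z\in N_{\mathcal R_Z}(Z)$ and $-H_S\in N_{\mathcal B_S}(S)$. A triple $(X,Y,S)\in\mathbb{R}^{m\times d}\times\mathbb{R}^{n\times d}\times\mathcal B$ is a stationary point of (F) if there is $(H_Z,H_S)\in\partial f(XY^{\mathbb T},S)$ with $-H_ZY\in N_{\mathcal C_X}(X)$, $-H_Z^{\mathbb T}X\in N_{\mathcal C_Y}(Y)$ and $-H_S\in N_{\mathcal B_S}(S)$. Then: (i) Every local minimizer $(Z,S)$ of (L) has the form $(XY^{\mathbb T},S)$ for some local minimizer $(X,Y,S)$ of (F), and every stationary point $(Z,S)$ of (L) has the form $(XY^{\mathbb T},S)$ for some stationary point $(X,Y,S)$ of (F). (ii) If $\lambda>0$, then the set of stationary points of (L) equals $\{(XY^{\mathbb T},S):(X,Y,S)\text{ is a stationary point of (F)}\}$. -/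

import Mathlib

open Filter Topology
-- Matrix spaces carry the Frobenius norm; its topology is the usual product topology.
open scoped Matrix Matrix.Norms.Frobenius

namespace RankL0

/-- The space of real `m × n` matrices. -/
abbrev Mat (m n : ℕ) : Type := Matrix (Fin m) (Fin n) ℝ

/-! ### Variational analysis: normal cones and subdifferentials -/

/-- The trace inner product `⟨A, B⟩ = trace (Aᵀ B)`. -/
def frobInner {m n : ℕ} (A B : Mat m n) : ℝ := (Aᵀ * B).trace

/-- The regular (Fréchet) normal cone to `Ω` at `U`: the `V` such that
`⟨V, Z - U⟩ ≤ o(‖Z - U‖)` for `Z ∈ Ω`. It is empty when `U ∉ Ω`. -/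
def regularNormalCone {m n : ℕ} (Ω : Set (Mat m n)) (U : Mat m n) : Set (Mat m n) :=
  {V | U ∈ Ω ∧ ∀ ε : ℝ, 0 < ε → ∀ᶠ Z in 𝓝[Ω] U, frobInner V (Z - U) ≤ ε * ‖Z - U‖}

/-- The (limiting, Mordukhovich) normal cone to `Ω` at `U`. It is empty when `U ∉ Ω`. -/
def normalCone {m n : ℕ} (Ω : Set (Mat m n)) (U : Mat m n) : Set (Mat m n) :=
  {V | U ∈ Ω ∧ ∃ (u v : ℕ → Mat m n),
    (∀ k, v k ∈ regularNormalCone Ω (u k)) ∧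
    Tendsto u atTop (𝓝 U) ∧ Tendsto v atTop (𝓝 V)}

/-- The regular (Fréchet) subdifferential at `p` of a real function of two matrix variables:
the `H` such that `f q ≥ f p + ⟨H, q - p⟩ - o(‖q - p‖)`. The norm on pairs is the maximum of the
two Frobenius norms, which gives the same `o(·)` condition as the Euclidean norm on pairs. -/
def regularSubdiff {m n : ℕ} (f : Mat m n × Mat m n → ℝ) (p : Mat m n × Mat m n) :
    Set (Mat m n × Mat m n) :=
  {H | ∀ ε : ℝ, 0 < ε → ∀ᶠ q in 𝓝 p,
    f p + (frobInner H.1 (q.1 - p.1) + frobInner H.2 (q.2 - p.2)) - ε * ‖q - p‖ ≤ f q}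

/-- The limiting (Mordukhovich) subdifferential. -/
def limitingSubdiff {m n : ℕ} (f : Mat m n × Mat m n → ℝ) (p : Mat m n × Mat m n) :
    Set (Mat m n × Mat m n) :=
  {H | ∃ (q h : ℕ → Mat m n × Mat m n),
    (∀ k, h k ∈ regularSubdiff f (q k)) ∧
    Tendsto q atTop (𝓝 p) ∧ Tendsto (fun k => f (q k)) atTop (𝓝 (f p)) ∧
    Tendsto h atTop (𝓝 H)}

/-! ### Counting functions, restrictions and the box constraint -/

/-- The number of nonzero columns. -/
noncomputable def nnzc {m d : ℕ} (X : Mat m d) : ℕ := Set.ncard {i : Fin d | X.col i ≠ 0}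

/-- The number of nonzero entries, `‖S‖₀`. -/
noncomputable def l0 {m n : ℕ} (S : Mat m n) : ℕ :=
  Set.ncard {p : Fin m × Fin n | S p.1 p.2 ≠ 0}

/-- The column index set `𝕀_U`: the nonzero columns if `lam > 0`, all columns otherwise. -/
def colIndex {m d : ℕ} (lam : ℝ) (U : Mat m d) : Set (Fin d) :=
  {i | 0 < lam → U.col i ≠ 0}

/-- The entry index set `𝕁_U`: the nonzero entries if `beta > 0`, all entries otherwise. -/
def entryIndex {m n : ℕ} (beta : ℝ) (U : Mat m n) : Set (Fin m × Fin n) :=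
  {p | 0 < beta → U p.1 p.2 ≠ 0}

open Classical in
/-- Replace by zero all columns with index outside `I`. -/
noncomputable def restrictCols {m d : ℕ} (I : Set (Fin d)) (U : Mat m d) : Mat m d :=
  Matrix.of fun r i => if i ∈ I then U r i else 0

open Classical in
/-- Replace by zero all entries with index outside `J`. -/
noncomputable def restrictEntries {m n : ℕ} (J : Set (Fin m × Fin n)) (U : Mat m n) : Mat m n :=
  Matrix.of fun i j => if (i, j) ∈ J then U i j else 0

/-- The box `[κ₁, κ₂]`, whose bounds may be infinite. -/
def box {m n : ℕ} (κ₁ κ₂ : Fin m → Fin n → EReal) : Set (Mat m n) :=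
  {S | ∀ i j, κ₁ i j ≤ (S i j : EReal) ∧ (S i j : EReal) ≤ κ₂ i j}

/-! ### The rank / `ℓ₀` problem (L): minimize `F₀(Z, S)` over `rank Z ≤ d`, `S ∈ B` -/

/-- The objective `F₀(Z, S) = f(Z, S) + 2 lam rank Z + beta ‖S‖₀`. -/
noncomputable def objL {m n : ℕ} (f : Mat m n × Mat m n → ℝ) (lam beta : ℝ)
    (p : Mat m n × Mat m n) : ℝ :=
  f p + 2 * lam * (p.1.rank : ℝ) + beta * (l0 p.2 : ℝ)

/-- The feasible set of (L). -/
def feasL {m n : ℕ} (d : ℕ) (B : Set (Mat m n)) : Set (Mat m n × Mat m n) :=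
  {p | p.1.rank ≤ d ∧ p.2 ∈ B}

/-- The local minimizers of (L). -/
def locMinL {m n : ℕ} (d : ℕ) (f : Mat m n × Mat m n → ℝ) (lam beta : ℝ) (B : Set (Mat m n)) :
    Set (Mat m n × Mat m n) :=
  {p | p ∈ feasL d B ∧ IsLocalMinOn (objL f lam beta) (feasL d B) p}

/-- The matrices `Z` with `rank Z ≤ d` and `lam rank Z = lam rank Z₀`. -/
def rankSet {m n : ℕ} (d : ℕ) (lam : ℝ) (Z₀ : Mat m n) : Set (Mat m n) :=
  {Z | Z.rank ≤ d ∧ lam * (Z.rank : ℝ) = lam * (Z₀.rank : ℝ)}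

/-- The stationary points of (L). As the normal cone to a set is empty at points outside it,
such points satisfy `rank Z ≤ d`. -/
def statL {m n : ℕ} (d : ℕ) (f : Mat m n × Mat m n → ℝ) (lam beta : ℝ) (B : Set (Mat m n)) :
    Set (Mat m n × Mat m n) :=
  {p | p.2 ∈ B ∧ ∃ H ∈ limitingSubdiff f p,
    -H.1 ∈ normalCone (rankSet d lam p.1) p.1 ∧
    -H.2 ∈ normalCone (restrictEntries (entryIndex beta p.2) '' B) p.2}

/-! ### The factorized problem (F): minimize `F(X, Y, S)` over all `X`, `Y` and `S ∈ B` -/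

/-- The map `(X, Y, S) ↦ (X Yᵀ, S)`. -/
def prodMap {m n d : ℕ} (q : Mat m d × Mat n d × Mat m n) : Mat m n × Mat m n :=
  (q.1 * q.2.1ᵀ, q.2.2)

/-- The objective `F(X, Y, S) = f(X Yᵀ, S) + lam (nnzc X + nnzc Y) + beta ‖S‖₀`. -/
noncomputable def objF {m n d : ℕ} (f : Mat m n × Mat m n → ℝ) (lam beta : ℝ)
    (q : Mat m d × Mat n d × Mat m n) : ℝ :=
  f (prodMap q) + lam * ((nnzc q.1 : ℝ) + (nnzc q.2.1 : ℝ)) + beta * (l0 q.2.2 : ℝ)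

/-- The feasible set of (F). -/
def feasF {m n : ℕ} (d : ℕ) (B : Set (Mat m n)) : Set (Mat m d × Mat n d × Mat m n) :=
  {q | q.2.2 ∈ B}

/-- The local minimizers of (F). -/
def locMinF {m n : ℕ} (d : ℕ) (f : Mat m n × Mat m n → ℝ) (lam beta : ℝ) (B : Set (Mat m n)) :
    Set (Mat m d × Mat n d × Mat m n) :=
  {q | q ∈ feasF d B ∧ IsLocalMinOn (objF f lam beta) (feasF d B) q}

/-- The stationary points of (F). The constraint sets for `X` and `Y` are the whole spaces,
restricted to the column index sets of `X` and of `Y`. -/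
def statF {m n : ℕ} (d : ℕ) (f : Mat m n × Mat m n → ℝ) (lam beta : ℝ) (B : Set (Mat m n)) :
    Set (Mat m d × Mat n d × Mat m n) :=
  {q | q.2.2 ∈ B ∧ ∃ H ∈ limitingSubdiff f (prodMap q),
    -(H.1 * q.2.1) ∈ normalCone (restrictCols (colIndex lam q.1) '' Set.univ) q.1 ∧
    -(H.1ᵀ * q.1) ∈ normalCone (restrictCols (colIndex lam q.2.1) '' Set.univ) q.2.1 ∧
    -H.2 ∈ normalCone (restrictEntries (entryIndex beta q.2.2) '' B) q.2.2}

end RankL0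

/-!
Stationarity on both sides reduces to the same pair of linear equations. If `V` is normal at `Z` to
a set of matrices of bounded, or of fixed, rank, then `V * Zᵀ = 0` and `Vᵀ * Z = 0`: the curves
`(1 + t A) Z` and `Z (1 + t A)` stay in the set for small `t`, since multiplication by an
invertible matrix preserves the rank, and a regular normal is orthogonal to the velocity of any
such curve (`mul_transpose_eq_zero_of_mem_normalCone`, `transpose_mul_eq_zero_of_mem_normalCone`).
The cones in the factorized problem are normal to linear subspaces, so there normality says that
the active columns of `H_Z Y` and of `H_Zᵀ X` vanish.

Going from (L) to (F), a factorization `Z = X Yᵀ` is used in which `X` and `Y` have at most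
`rank Z` nonzero columns, the columns of `X` lie in the range of `Z`, and those of `Y` in the range
of `Zᵀ` (`exists_balanced_factorization`). The range conditions turn the two equations into
`H_Z Y = 0` and `H_Zᵀ X = 0`; the count of columns gives the statement on local minimizers, because
`2 rank (X Yᵀ) ≤ nnzc X + nnzc Y` for all `X` and `Y`.

Going from (F) to (L) when `lam > 0`, the converse for matrices of fixed rank is needed: `V` with
`V * Zᵀ = 0` and `Vᵀ * Z = 0` is a regular normal at `Z`. If `rank W = rank Z` and `W` is near `Z`,
then `W = W K W` with `K` depending continuously on `W` (`mul_generalizedInverse_mul_self`).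
For `D = W - Z` this gives `⟨V, D⟩ = ⟨V, D K D⟩`, which is of second order in `D`
(`mem_regularNormalCone_rankSet`).
-/

namespace RankL0

variable {m n d r : ℕ}

/-! ### The trace inner product -/

@[simp] lemma frobInner_zero_left (A : Mat m n) : frobInner 0 A = 0 := by simp [frobInner]

lemma frobInner_smul_right (A B : Mat m n) (t : ℝ) :
    frobInner A (t • B) = t * frobInner A B := by
  simp [frobInner]

lemma eq_zero_of_frobInner_self {A : Mat m n} (h : frobInner A A = 0) : A = 0 :=
  Matrix.trace_conjTranspose_mul_self_eq_zero_iff.1 (by simpa [frobInner] using h)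

lemma frobInner_le_norm_mul_norm (A B : Mat m n) : frobInner A B ≤ ‖A‖ * ‖B‖ := by
  have hnorm : ∀ M : Mat m n, ‖M‖ = √(∑ p : Fin m × Fin n, M p.1 p.2 ^ 2) := by
    intro M
    rw [Matrix.frobenius_norm_def, Real.sqrt_eq_rpow, Fintype.sum_prod_type]
    simp
  have hinner : frobInner A B = ∑ p : Fin m × Fin n, A p.1 p.2 * B p.1 p.2 := by
    simp only [frobInner, Matrix.trace, Matrix.diag_apply, Matrix.mul_apply,
      Matrix.transpose_apply]
    rw [Finset.sum_comm, Fintype.sum_prod_type]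
  rw [hnorm, hnorm, hinner]
  exact Real.sum_mul_le_sqrt_mul_sqrt _ _ _

/-! ### Normals along lines and limits of normals -/

/-- A regular normal is orthogonal to every direction in which a two-sided line segment stays in
the set. -/
lemma frobInner_eq_zero_of_line {Ω : Set (Mat m n)} {U V A : Mat m n}
    (hV : V ∈ regularNormalCone Ω U) (hA : ∀ᶠ t : ℝ in 𝓝 0, U + t • A ∈ Ω) :
    frobInner V A = 0 := by
  have hline : Tendsto (fun t : ℝ => U + t • A) (𝓝 0) (𝓝[Ω] U) := by
    refine tendsto_nhdsWithin_iff.2 ⟨?_, hA⟩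
    have : Continuous fun t : ℝ => U + t • A := by fun_prop
    simpa using this.tendsto 0
  have key : ∀ ε : ℝ, 0 < ε → |frobInner V A| ≤ ε * ‖A‖ := by
    intro ε hε
    have h := hline.eventually (hV.2 ε hε)
    obtain ⟨δ, hδ, h⟩ := Metric.eventually_nhds_iff.1 h
    -- Both signs of `t` are tested, so that the one-sided bound becomes a bound on `|⟨V, A⟩|`.
    have hpos := h (y := δ / 2) (by simp [abs_of_pos hδ]; linarith)
    have hneg := h (y := -(δ / 2)) (by simp [abs_of_pos hδ]; linarith)
    simp only [add_sub_cancel_left, frobInner_smul_right, norm_smul, norm_neg,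
      Real.norm_eq_abs, abs_of_pos (half_pos hδ)] at hpos hneg
    rw [abs_le]
    constructor <;> nlinarith
  by_contra hne
  have hp : 0 < |frobInner V A| := abs_pos.2 hne
  have h := key (|frobInner V A| / (2 * (‖A‖ + 1))) (by positivity)
  have hlt : |frobInner V A| / (2 * (‖A‖ + 1)) * ‖A‖ < |frobInner V A| := by
    rw [div_mul_eq_mul_div, div_lt_iff₀ (by positivity)]
    nlinarith [norm_nonneg A]
  linarith

/-- A closed condition satisfied by all regular normals is satisfied by all limiting normals. -/
lemma eq_zero_of_mem_normalCone {E : Type*} [TopologicalSpace E] [T2Space E] [Zero E]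
    {Ω : Set (Mat m n)} {U V : Mat m n} (g : Mat m n × Mat m n → E) (hg : Continuous g)
    (h : ∀ u v, v ∈ regularNormalCone Ω u → g (u, v) = 0) (hV : V ∈ normalCone Ω U) :
    g (U, V) = 0 := by
  obtain ⟨-, u, v, huv, hu, hv⟩ := hV
  have hlim := (hg.tendsto (U, V)).comp (hu.prodMk_nhds hv)
  refine tendsto_nhds_unique hlim ?_
  simp [Function.comp_def, h _ _ (huv _)]

lemma regularNormalCone_subset_normalCone (Ω : Set (Mat m n)) (U : Mat m n) :
    regularNormalCone Ω U ⊆ normalCone Ω U := fun V hV =>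
  ⟨hV.1, fun _ => U, fun _ => V, fun _ => hV, tendsto_const_nhds, tendsto_const_nhds⟩

lemma zero_mem_normalCone {Ω : Set (Mat m n)} {U : Mat m n} (hU : U ∈ Ω) :
    0 ∈ normalCone Ω U :=
  regularNormalCone_subset_normalCone Ω U ⟨hU, fun ε hε => Eventually.of_forall fun Z => by
    rw [frobInner_zero_left]; positivity⟩

/-! ### Normals to the column subspaces -/

open Classical in
/-- The coordinate projection onto the indices in `I`, as a diagonal matrix. -/
noncomputable def colProj (I : Set (Fin d)) : Matrix (Fin d) (Fin d) ℝ :=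
  Matrix.diagonal fun i => if i ∈ I then 1 else 0

lemma restrictCols_eq_mul (I : Set (Fin d)) (U : Mat m d) :
    restrictCols I U = U * colProj I := by
  ext i j
  simp [restrictCols, colProj]

@[simp] lemma colProj_transpose (I : Set (Fin d)) : (colProj I)ᵀ = colProj I := by
  simp [colProj]

@[simp] lemma colProj_mul_self (I : Set (Fin d)) : colProj I * colProj I = colProj I := by
  simp [colProj]

lemma mul_colProj_colIndex (lam : ℝ) (U : Mat m d) : U * colProj (colIndex lam U) = U := by
  ext i j
  by_cases h : U.col j = 0
  · have : U i j = 0 := congrFun h i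
    simp [colProj, this]
  · simp [colProj, colIndex, h]

lemma mem_restrictCols_colIndex (lam : ℝ) (U : Mat m d) :
    U ∈ restrictCols (colIndex lam U) '' Set.univ :=
  ⟨U, trivial, by rw [restrictCols_eq_mul, mul_colProj_colIndex]⟩

lemma mul_colProj_eq_zero_of_mem_normalCone {I : Set (Fin d)} {U V : Mat m d}
    (hV : V ∈ normalCone (restrictCols I '' Set.univ) U) : V * colProj I = 0 := by
  refine eq_zero_of_mem_normalCone (fun p => p.2 * colProj I) (by fun_prop) ?_ hV
  rintro u v hv
  obtain ⟨W, -, rfl⟩ := hv.1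
  have h : frobInner v (v * colProj I) = 0 := by
    refine frobInner_eq_zero_of_line hv (Eventually.of_forall fun t => ⟨W + t • v, trivial, ?_⟩)
    simp [restrictCols_eq_mul, Matrix.add_mul]
  refine eq_zero_of_frobInner_self ?_
  rw [← h]
  simp only [frobInner, Matrix.transpose_mul, colProj_transpose]
  rw [Matrix.mul_assoc, Matrix.trace_mul_comm, Matrix.mul_assoc, Matrix.mul_assoc,
    colProj_mul_self]

/-! ### Normals to sets of matrices of bounded or fixed rank -/

lemma eventually_det_one_add_smul_ne_zero (A : Matrix (Fin n) (Fin n) ℝ) :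
    ∀ᶠ t : ℝ in 𝓝 0, (1 + t • A).det ≠ 0 := by
  have hc : Continuous fun t : ℝ => (1 + t • A).det := by fun_prop
  exact (hc.tendsto 0).eventually_ne (by simp)

lemma mul_transpose_eq_zero_of_mem_normalCone {lam : ℝ} {Z₀ U V : Mat m n}
    (hV : V ∈ normalCone (rankSet d lam Z₀) U) : V * Uᵀ = 0 := by
  refine eq_zero_of_mem_normalCone (fun p => p.2 * p.1ᵀ) (by fun_prop) ?_ hV
  intro u v hv
  have h : frobInner v ((v * uᵀ) * u) = 0 := by
    -- The direction `(v * uᵀ) * u` is chosen so that the pairing is `‖v * uᵀ‖²`.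
    refine frobInner_eq_zero_of_line hv ?_
    filter_upwards [eventually_det_one_add_smul_ne_zero (v * uᵀ)] with t ht
    have e : u + t • (v * uᵀ * u) = (1 + t • (v * uᵀ)) * u := by
      rw [Matrix.add_mul, Matrix.one_mul, Matrix.smul_mul]
    rw [e, rankSet, Set.mem_ofPred_eq, Matrix.rank_mul_eq_right_of_det_ne_zero _ _ ht]
    exact hv.1
  refine eq_zero_of_frobInner_self ?_
  rw [← h]
  simp only [frobInner, Matrix.transpose_mul, Matrix.transpose_transpose]
  rw [Matrix.mul_assoc, Matrix.trace_mul_comm, Matrix.mul_assoc]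

lemma transpose_mul_eq_zero_of_mem_normalCone {lam : ℝ} {Z₀ U V : Mat m n}
    (hV : V ∈ normalCone (rankSet d lam Z₀) U) : Vᵀ * U = 0 := by
  refine eq_zero_of_mem_normalCone (fun p => p.2ᵀ * p.1) (by fun_prop) ?_ hV
  intro u v hv
  have h : frobInner v (u * (uᵀ * v)) = 0 := by
    refine frobInner_eq_zero_of_line hv ?_
    filter_upwards [eventually_det_one_add_smul_ne_zero (uᵀ * v)] with t ht
    have e : u + t • (u * (uᵀ * v)) = u * (1 + t • (uᵀ * v)) := by
      rw [Matrix.mul_add, Matrix.mul_one, Matrix.mul_smul]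
    rw [e, rankSet, Set.mem_ofPred_eq, Matrix.rank_mul_eq_left_of_det_ne_zero _ _ ht]
    exact hv.1
  refine eq_zero_of_frobInner_self ?_
  rw [← h]
  simp only [frobInner, Matrix.transpose_mul, Matrix.transpose_transpose]
  rw [Matrix.trace_mul_comm, Matrix.mul_assoc]

/-- A matrix of rank `r` can be compressed to the identity of size `r`, by factors that also yield
a generalized inverse `R * A`. -/
lemma exists_rank_compression (Z : Mat m n) :
    ∃ (A : Mat Z.rank m) (R : Mat n Z.rank), A * Z * R = 1 ∧ Z * R * A * Z = Z := by
  let T := Matrix.toLin' Z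
  have hr : Module.finrank ℝ (LinearMap.range T) = Module.finrank ℝ (Fin Z.rank → ℝ) := by
    rw [Module.finrank_fin_fun]; rfl
  let e := LinearEquiv.ofFinrankEq _ _ hr
  obtain ⟨g, hg⟩ := T.rangeRestrict.exists_rightInverse_of_surjective T.range_rangeRestrict
  obtain ⟨p, hp⟩ := (LinearMap.range T).subtype.exists_leftInverse_of_injective (by simp)
  have hpT : ∀ x, p (T x) = T.rangeRestrict x := fun x => LinearMap.congr_fun hp ⟨T x, x, rfl⟩
  have hTg : ∀ y, T.rangeRestrict (g y) = y := fun y => LinearMap.congr_fun hg y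
  have hTg' : ∀ y, T (g y) = y := fun y => congrArg Subtype.val (hTg y)
  have hZ : Z = LinearMap.toMatrix' T := (LinearMap.toMatrix'_toLin' Z).symm
  refine ⟨LinearMap.toMatrix' (e.toLinearMap ∘ₗ p), LinearMap.toMatrix' (g ∘ₗ e.symm.toLinearMap),
    ?_, ?_⟩
  · apply Matrix.toLin'.injective
    ext1 i
    ext1
    simp only [Matrix.toLin'_mul, Matrix.toLin'_toMatrix', LinearMap.comp_apply,
      LinearEquiv.coe_coe, Matrix.toLin'_one, LinearMap.id_apply]
    change e (p (T _)) = _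
    rw [hpT, hTg, LinearEquiv.apply_symm_apply]
  · apply Matrix.toLin'.injective
    refine LinearMap.ext fun x => ?_
    simp only [Matrix.toLin'_mul, Matrix.toLin'_toMatrix', LinearMap.comp_apply,
      LinearEquiv.coe_coe]
    change T (g (e.symm (e (p (T x))))) = T x
    rw [LinearEquiv.symm_apply_apply, hTg', hpT]
    rfl

/-- If a compression of `W` to size `rank W` is invertible, its inverse gives a generalized inverse
of `W`. -/
lemma mul_generalizedInverse_mul_self {W : Mat m n} {A : Mat r m} {R : Mat n r}
    (hW : W.rank = r) (hdet : (A * W * R).det ≠ 0) :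
    W * (R * (A * W * R)⁻¹ * A) * W = W := by
  have hunit : IsUnit (A * W * R).det := isUnit_iff_ne_zero.2 hdet
  have hle : r ≤ (W * R).rank := by
    have h := Matrix.rank_mul_le_right A (W * R)
    rwa [← Matrix.mul_assoc, Matrix.rank_of_det_ne_zero hdet, Fintype.card_fin] at h
  have hsub : LinearMap.range (Matrix.toLin' (W * R)) ≤ LinearMap.range (Matrix.toLin' W) := by
    rw [Matrix.toLin'_mul]
    exact LinearMap.range_comp_le_range _ _
  -- The columns of `W * R` lie in the range of `W`, and there are enough independent ones.
  have hrange : LinearMap.range (Matrix.toLin' (W * R)) = LinearMap.range (Matrix.toLin' W) := by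
    refine Submodule.eq_of_le_of_finrank_le hsub ?_
    change W.rank ≤ (W * R).rank
    rwa [hW]
  apply Matrix.toLin'.injective
  refine LinearMap.ext fun x => ?_
  obtain ⟨c, hc⟩ : Matrix.toLin' W x ∈ LinearMap.range (Matrix.toLin' (W * R)) :=
    hrange ▸ LinearMap.mem_range_self _ x
  simp only [Matrix.toLin'_apply] at hc ⊢
  have e : W * (R * (A * W * R)⁻¹ * A) * (W * R) = W * R := by
    rw [show W * (R * (A * W * R)⁻¹ * A) * (W * R) = W * R * ((A * W * R)⁻¹ * (A * W * R)) by
      simp only [Matrix.mul_assoc], Matrix.nonsing_inv_mul _ hunit, Matrix.mul_one]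
  rw [← Matrix.mulVec_mulVec, ← hc, Matrix.mulVec_mulVec, e]

/-- With `D = W - Z`, the terms of `W = (Z + D) K (Z + D)` that contain `Z` are orthogonal to `V`,
so only the quadratic term `D K D` remains. -/
lemma frobInner_sub_eq {V Z W : Mat m n} {K : Mat n m} (h1 : V * Zᵀ = 0) (h2 : Vᵀ * Z = 0)
    (hK : W * K * W = W) : frobInner V (W - Z) = frobInner V ((W - Z) * K * (W - Z)) := by
  have h3 : Z * Vᵀ = 0 := by simpa using congrArg Matrix.transpose h1
  have hr : (Vᵀ * (W * K * Z)).trace = 0 := by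
    rw [← Matrix.mul_assoc, Matrix.trace_mul_comm, ← Matrix.mul_assoc, h3]; simp
  have hl : ∀ M : Matrix (Fin n) (Fin n) ℝ, (Vᵀ * (Z * M)).trace = 0 := by
    intro M; rw [← Matrix.mul_assoc, h2]; simp
  simp only [frobInner, Matrix.sub_mul, Matrix.mul_sub, Matrix.trace_sub, hK, hr, h2]
  simp [Matrix.mul_assoc, hl]

/-- The two equations are sufficient for normality to a set of matrices of fixed rank. -/
lemma mem_regularNormalCone_rankSet {lam : ℝ} (hlam : 0 < lam) {V Z : Mat m n}
    (hZ : Z.rank ≤ d) (h1 : V * Zᵀ = 0) (h2 : Vᵀ * Z = 0) :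
    V ∈ regularNormalCone (rankSet d lam Z) Z := by
  refine ⟨⟨hZ, rfl⟩, fun ε hε => ?_⟩
  obtain ⟨A, R, hAR, -⟩ := exists_rank_compression Z
  have hdetc : Continuous fun W : Mat m n => (A * W * R).det := by fun_prop
  have hdet : ∀ᶠ W in 𝓝 Z, (A * W * R).det ≠ 0 :=
    (hdetc.tendsto Z).eventually_ne (by simp [hAR])
  have hinv : ContinuousAt (fun W : Mat m n => (A * W * R)⁻¹) Z := by
    have h : (fun W : Mat m n => (A * W * R)⁻¹) =
        fun W : Mat m n => (A * W * R).det⁻¹ • (A * W * R).adjugate := by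
      funext W; rw [Matrix.inv_def, Ring.inverse_eq_inv']
    rw [h]
    refine (hdetc.continuousAt.inv₀ (by simp [hAR])).smul ?_
    exact Continuous.continuousAt (by fun_prop)
  have hK : ContinuousAt (fun W : Mat m n => R * (A * W * R)⁻¹ * A) Z := by fun_prop
  have hsmall : Tendsto (fun W : Mat m n => ‖V‖ * (‖W - Z‖ * ‖R * (A * W * R)⁻¹ * A‖))
      (𝓝 Z) (𝓝 0) := by
    have hsub : ContinuousAt (fun W : Mat m n => W - Z) Z := by fun_prop
    have h := (hsub.norm.mul hK.norm).const_mul ‖V‖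
    simpa using h.tendsto
  filter_upwards [nhdsWithin_le_nhds hdet,
    nhdsWithin_le_nhds (hsmall.eventually (eventually_le_nhds hε)), self_mem_nhdsWithin]
    with W hWdet hWε hW
  have hrank : W.rank = Z.rank := by exact_mod_cast mul_left_cancel₀ hlam.ne' hW.2
  have hWK := mul_generalizedInverse_mul_self hrank hWdet
  rw [frobInner_sub_eq h1 h2 hWK]
  set K := R * (A * W * R)⁻¹ * A
  calc frobInner V ((W - Z) * K * (W - Z)) ≤ ‖V‖ * ‖(W - Z) * K * (W - Z)‖ :=
        frobInner_le_norm_mul_norm _ _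
    _ ≤ ‖V‖ * (‖W - Z‖ * ‖K‖ * ‖W - Z‖) := by
        gcongr
        exact (Matrix.frobenius_norm_mul _ _).trans
          (by gcongr; exact Matrix.frobenius_norm_mul _ _)
    _ = ‖V‖ * (‖W - Z‖ * ‖K‖) * ‖W - Z‖ := by ring
    _ ≤ ε * ‖W - Z‖ := by gcongr

/-! ### Factorizations -/

lemma rank_le_nnzc (X : Mat m d) : X.rank ≤ nnzc X := by
  classical
  rw [← Matrix.rank_transpose, nnzc, Set.ncard_eq_toFinset_card']
  refine Matrix.rank_le_card_of_support_subset _ _ fun i hi => ?_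
  simpa using hi

lemma rank_mul_transpose_le (X : Mat m d) (Y : Mat n d) :
    2 * (X * Yᵀ).rank ≤ nnzc X + nnzc Y := by
  have h1 := (Matrix.rank_mul_le_left X Yᵀ).trans (rank_le_nnzc X)
  have h2 := (Matrix.rank_mul_le_right X Yᵀ).trans
    ((Matrix.rank_transpose Y).le.trans (rank_le_nnzc Y))
  omega

/-- Appending zero columns does not increase the number of nonzero columns. -/
lemma nnzc_mul_padding_le (hrd : r ≤ d) (X : Mat m r) :
    nnzc (X * (1 : Matrix (Fin d) (Fin d) ℝ).submatrix (Fin.castLE hrd) id) ≤ r := by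
  have hsub : {i : Fin d | (X * (1 : Matrix (Fin d) (Fin d) ℝ).submatrix
      (Fin.castLE hrd) id).col i ≠ 0} ⊆ Set.range (Fin.castLE hrd) := by
    intro i hi
    by_contra hni
    refine hi (funext fun k => ?_)
    have hne : ∀ j, Fin.castLE hrd j ≠ i := fun j hj => hni ⟨j, hj⟩
    simp [Matrix.mul_apply, hne]
  calc nnzc _ ≤ (Set.range (Fin.castLE hrd)).ncard := Set.ncard_le_ncard hsub (Set.toFinite _)
    _ = r := by
      rw [← Nat.card_coe_set_eq, Nat.card_range_of_injective (Fin.castLE_injective hrd),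
        Nat.card_fin]

/-- A factorization with as few nonzero columns as possible, whose factors have their columns in
the range of `Z` and of `Zᵀ`. -/
lemma exists_balanced_factorization (Z : Mat m n) (hZ : Z.rank ≤ d) :
    ∃ (X : Mat m d) (Y : Mat n d) (P : Mat n d) (Q : Mat m d),
      X * Yᵀ = Z ∧ X = Z * P ∧ Y = Zᵀ * Q ∧ nnzc X ≤ Z.rank ∧ nnzc Y ≤ Z.rank := by
  obtain ⟨A, R, -, hZRAZ⟩ := exists_rank_compression Z
  let E := (1 : Matrix (Fin d) (Fin d) ℝ).submatrix (Fin.castLE hZ) id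
  have hE : E * Eᵀ = 1 := by
    have h := Matrix.submatrix_mul_equiv (1 : Matrix (Fin d) (Fin d) ℝ) 1
      (Fin.castLE hZ) (Equiv.refl _) (Fin.castLE hZ)
    rw [Matrix.one_mul, Matrix.submatrix_one _ (Fin.castLE_injective hZ)] at h
    rw [Matrix.transpose_submatrix, Matrix.transpose_one]
    exact h
  refine ⟨Z * R * E, (A * Z)ᵀ * E, R * E, Aᵀ * E, ?_, ?_, ?_,
    nnzc_mul_padding_le hZ _, nnzc_mul_padding_le hZ _⟩
  · rw [Matrix.transpose_mul, Matrix.transpose_transpose, Matrix.mul_assoc (Z * R),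
      ← Matrix.mul_assoc E, hE, Matrix.one_mul, ← Matrix.mul_assoc, hZRAZ]
  · rw [Matrix.mul_assoc]
  · rw [Matrix.transpose_mul, Matrix.mul_assoc]

/-! ### Comparison of the two problems -/

variable {f : Mat m n × Mat m n → ℝ} {lam beta : ℝ} {B : Set (Mat m n)}

lemma objL_prodMap_le_objF (hlam : 0 ≤ lam) (q : Mat m d × Mat n d × Mat m n) :
    objL f lam beta (prodMap q) ≤ objF f lam beta q := by
  have h : (2 : ℝ) * ((q.1 * q.2.1ᵀ).rank : ℝ) ≤ nnzc q.1 + nnzc q.2.1 := by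
    exact_mod_cast rank_mul_transpose_le q.1 q.2.1
  have h' := mul_le_mul_of_nonneg_left h hlam
  simp only [objL, objF, prodMap]
  linarith

lemma prodMap_mem_feasL {q : Mat m d × Mat n d × Mat m n} (hq : q ∈ feasF d B) :
    prodMap q ∈ feasL d B :=
  ⟨(Matrix.rank_mul_le_left _ _).trans (Matrix.rank_le_width _), hq⟩

lemma locMinL_subset_image_locMinF (hlam : 0 ≤ lam) :
    locMinL d f lam beta B ⊆ prodMap '' locMinF d f lam beta B := by
  rintro ⟨Z, S⟩ ⟨⟨hZ, hS⟩, hmin⟩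
  -- With this factorization both column counts are `rank Z`, so the two objectives agree there.
  obtain ⟨X, Y, -, -, hXY, -, -, hX, hY⟩ := exists_balanced_factorization Z hZ
  have hprod : prodMap (X, Y, S) = (Z, S) := by simp [prodMap, hXY]
  refine ⟨(X, Y, S), ⟨hS, ?_⟩, hprod⟩
  have hval : objF f lam beta (X, Y, S) ≤ objL f lam beta (Z, S) := by
    have h : (nnzc X : ℝ) + nnzc Y ≤ 2 * (Z.rank : ℝ) := by
      exact_mod_cast (by omega : nnzc X + nnzc Y ≤ 2 * Z.rank)
    have h' := mul_le_mul_of_nonneg_left h hlam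
    simp only [objL, objF, hprod]
    linarith
  have hcont : Continuous (prodMap : Mat m d × Mat n d × Mat m n → _) := by
    unfold prodMap; fun_prop
  have hlim : Tendsto prodMap (𝓝[feasF d B] (X, Y, S)) (𝓝[feasL d B] (Z, S)) := by
    refine tendsto_nhdsWithin_iff.2 ⟨?_, ?_⟩
    · rw [← hprod]; exact (hcont.tendsto _).mono_left nhdsWithin_le_nhds
    · filter_upwards [self_mem_nhdsWithin] with q hq using prodMap_mem_feasL hq
  filter_upwards [hlim.eventually hmin] with q hq
  exact hval.trans (hq.trans (objL_prodMap_le_objF hlam q))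

lemma statL_subset_image_statF :
    statL d f lam beta B ⊆ prodMap '' statF d f lam beta B := by
  rintro ⟨Z, S⟩ ⟨hS, H, hH, hHZ, hHS⟩
  obtain ⟨X, Y, P, Q, hXY, hX, hY, -, -⟩ := exists_balanced_factorization Z hHZ.1.1
  have hprod : prodMap (X, Y, S) = (Z, S) := by simp [prodMap, hXY]
  have h1 : H.1 * Zᵀ = 0 := by simpa using mul_transpose_eq_zero_of_mem_normalCone hHZ
  have h2 : H.1ᵀ * Z = 0 := by simpa using transpose_mul_eq_zero_of_mem_normalCone hHZ
  have hHY : H.1 * Y = 0 := by rw [hY, ← Matrix.mul_assoc, h1, Matrix.zero_mul]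
  have hHX : H.1ᵀ * X = 0 := by rw [hX, ← Matrix.mul_assoc, h2, Matrix.zero_mul]
  refine ⟨(X, Y, S), ⟨hS, H, by rwa [hprod], ?_, ?_, hHS⟩, hprod⟩
  · simp only [hHY, neg_zero]
    exact zero_mem_normalCone (mem_restrictCols_colIndex lam X)
  · simp only [hHX, neg_zero]
    exact zero_mem_normalCone (mem_restrictCols_colIndex lam Y)

lemma image_statF_subset_statL (hlam : 0 < lam) :
    prodMap '' statF d f lam beta B ⊆ statL d f lam beta B := by
  rintro _ ⟨⟨X, Y, S⟩, ⟨hS, H, hH, hHX, hHY, hHS⟩, rfl⟩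
  simp only at hHX hHY
  have h1 := mul_colProj_eq_zero_of_mem_normalCone hHX
  have h2 := mul_colProj_eq_zero_of_mem_normalCone hHY
  rw [Matrix.neg_mul] at h1 h2
  refine ⟨hS, H, hH, regularNormalCone_subset_normalCone _ _
    (mem_regularNormalCone_rankSet hlam (prodMap_mem_feasL (B := B) hS).1 ?_ ?_), hHS⟩
  -- Only the active columns of `X` and of `Y` contribute to the products with `X * Yᵀ`.
  · have e : H.1 * (X * Yᵀ)ᵀ = H.1 * Y * colProj (colIndex lam X) * Xᵀ := by
      conv_lhs => rw [← mul_colProj_colIndex lam X]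
      simp [Matrix.mul_assoc]
    simp only [prodMap, Matrix.neg_mul, e, neg_eq_zero.1 h1, Matrix.zero_mul, neg_zero]
  · have e : H.1ᵀ * (X * Yᵀ) = H.1ᵀ * X * colProj (colIndex lam Y) * Yᵀ := by
      conv_lhs => rw [← mul_colProj_colIndex lam Y]
      simp [Matrix.mul_assoc]
    simp [prodMap, e, neg_eq_zero.1 h2]

end RankL0

theorem mainTheorem1 (m n d : ℕ)
    (f : RankL0.Mat m n × RankL0.Mat m n → ℝ) (hf_nonneg : ∀ p, 0 ≤ f p)
    (hf_lip : LocallyLipschitz f)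
    (lam beta : ℝ) (hlam : 0 ≤ lam) (hbeta : 0 ≤ beta)
    (κ₁ κ₂ : Fin m → Fin n → EReal) (hκ₁ : ∀ i j, κ₁ i j ≤ 0) (hκ₂ : ∀ i j, 0 ≤ κ₂ i j) :
    (RankL0.locMinL d f lam beta (RankL0.box κ₁ κ₂) ⊆
        RankL0.prodMap '' RankL0.locMinF d f lam beta (RankL0.box κ₁ κ₂) ∧
      RankL0.statL d f lam beta (RankL0.box κ₁ κ₂) ⊆
        RankL0.prodMap '' RankL0.statF d f lam beta (RankL0.box κ₁ κ₂)) ∧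
    (0 < lam →
      RankL0.statL d f lam beta (RankL0.box κ₁ κ₂) =
        RankL0.prodMap '' RankL0.statF d f lam beta (RankL0.box κ₁ κ₂)) := by
  exact ⟨⟨RankL0.locMinL_subset_image_locMinF hlam, RankL0.statL_subset_image_statF⟩,
    fun h => Set.Subset.antisymm RankL0.statL_subset_image_statF
      (RankL0.image_statF_subset_statL h)⟩
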